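/- **Theorem 1.3 (Strict convexity of Kantorovich potentials).** There is a universal constant $C>0$ with the following property. Let $\Omega\subset\mathbb R^2$ be open and bounded, let $\mu,\nu$ be non-negative Radon measures on $\mathbb R^2$, and let $\psi:\mathbb R^2\to\mathbb R$ be convex with $$\mu(A)\le\nu(\partial\psi(A))\quad\text{for all Borel sets }A\subset\Omega,$$ where $\partial\psi(x)=\{z:\psi(y)\ge\psi(x)+z\cdot(y-x)\ \forall y\in\mathbb R^2\}$ and $\partial\psi(A)=\bigcup_{x\in A}\partial\psi(x)$. Let $h_1,h_2,\lambda_1,\lambda_2>0$ be such that $$\mu(R)\ge\frac{|R|}{\lambda_1},\qquad \nu(R'\cap\partial\psi(\Omega))\le\lambda_2|R'|$$ for all (closed, arbitrarily oriented) rectangles $R\subset\Omega$ with both side lengths at least $h_1$ and $R'\subset\mathbb R^2$ with both side lengths at least $h_2$. Let $\delta>0$ and let $x,y\in\Omega^\delta:=\{p\in\Omega:\operatorname{dist}(p,\partial\Omega)>\delta\}$ be such that $U_\delta:=\bigcup_{z\in[x,y]}B_\delta(z)\subset\Omega$ (which is automatic when $\Omega$ is convex). Let $K>0$ satisfy $K\ge\operatorname{diam}\partial\psi(U_\delta)$,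 put $\ell=|x-y|/2$ and $$\varepsilon=-\min_{t\in[0,1]}\Big(\psi((1-t)x+ty)-\big[(1-t)\psi(x)+t\psi(y)\big]\Big)\ge 0 .$$ If $$\ell\ge 2h_1,\qquad \ell^2\ge C\,K\,\lambda_1\lambda_2\,h_2,\qquad \gamma:=\max\Big\{\frac{\varepsilon}{K},\,2h_1,\,\frac{\ell h_2}{C\,K}\Big\}\le\frac{\delta}{2},$$ then $$\ell^8\,\log\Big(1+\frac{\delta}{\gamma}\Big)\le C^4\,\lambda_1^4\lambda_2^4K^8 .$$ -/

import Mathlib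

open MeasureTheory

/-- The Euclidean plane, with the Euclidean norm and its Borel σ-algebra. -/
abbrev Plane : Type := EuclideanSpace ℝ (Fin 2)

/-- The subdifferential `∂ψ(x)`. -/
def subdiff (ψ : Plane → ℝ) (x : Plane) : Set Plane :=
  {z | ∀ y : Plane, ψ x + inner ℝ z (y - x) ≤ ψ y}

/-- `∂ψ(A)`, the union of `∂ψ(x)` over `x ∈ A`. -/
def subdiffImage (ψ : Plane → ℝ) (A : Set Plane) : Set Plane :=
  ⋃ x ∈ A, subdiff ψ x

/-- The closed rectangle with centre `c` and sides of lengths `a` and `b` in the directions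
`u` and `v`; it is used for orthonormal `u`, `v`, so that its area is `a * b`. -/
def rectangle (c u v : Plane) (a b : ℝ) : Set Plane :=
  {p | ∃ s t : ℝ, |s| ≤ a / 2 ∧ |t| ≤ b / 2 ∧ p = c + s • u + t • v}

/-- The measure inequality `μ(A) ≤ ν(∂ψ(A))` for all Borel sets `A ⊆ Ω`. -/
def IsLocalPotential (ψ : Plane → ℝ) (Ω : Set Plane) (μ ν : Measure Plane) : Prop :=
  ∀ A : Set Plane, MeasurableSet A → A ⊆ Ω → μ A ≤ ν (subdiffImage ψ A)

/-- The density bounds on `μ` and `ν` down to the scales `h₁` and `h₂`: for rectangles of any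
orientation, `μ(R) ≥ |R| / lam₁` if `R ⊆ Ω` has both sides at least `h₁`, and
`ν(R' ∩ ∂ψ(Ω)) ≤ lam₂ |R'|` if `R'` has both sides at least `h₂`. -/
structure DensityBounds (ψ : Plane → ℝ) (Ω : Set Plane) (μ ν : Measure Plane)
    (h₁ h₂ lam₁ lam₂ : ℝ) : Prop where
  h₁_pos : 0 < h₁
  h₂_pos : 0 < h₂
  lam₁_pos : 0 < lam₁
  lam₂_pos : 0 < lam₂
  lower : ∀ (c u v : Plane) (a b : ℝ), ‖u‖ = 1 → ‖v‖ = 1 → inner ℝ u v = 0 →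
    h₁ ≤ a → h₁ ≤ b → rectangle c u v a b ⊆ Ω →
    ENNReal.ofReal (a * b / lam₁) ≤ μ (rectangle c u v a b)
  upper : ∀ (c u v : Plane) (a b : ℝ), ‖u‖ = 1 → ‖v‖ = 1 → inner ℝ u v = 0 →
    h₂ ≤ a → h₂ ≤ b →
    ν (rectangle c u v a b ∩ subdiffImage ψ Ω) ≤ ENNReal.ofReal (lam₂ * (a * b))

/-- `Ω^δ`, the points of `Ω` at distance more than `δ` from the boundary of `Ω`. -/
def innerSet (Ω : Set Plane) (δ : ℝ) : Set Plane :=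
  {x | x ∈ Ω ∧ ENNReal.ofReal δ < Metric.infEDist x (frontier Ω)}

/-- `U_δ`, the union of the open balls of radius `δ` centred on the segment `[x, y]`. -/
def segmentNhd (x y : Plane) (δ : ℝ) : Set Plane :=
  ⋃ z ∈ segment ℝ x y, Metric.ball z δ

/-- The number `ε = - min_{t ∈ [0,1]} (ψ((1-t)x + ty) - [(1-t)ψ(x) + tψ(y)])`. The infimum is a
minimum when `ψ` is convex, since `ψ` is then continuous. -/
noncomputable def chordGap (ψ : Plane → ℝ) (x y : Plane) : ℝ :=
  -sInf ((fun t : ℝ => ψ ((1 - t) • x + t • y) - ((1 - t) * ψ x + t * ψ y)) '' Set.Icc 0 1)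

/-! Write ε for the chord gap, m for the midpoint of the segment, u and v for its tangent and
normal, L = lam₁ * lam₂. On a rectangle where the subgradients fill only a small box, the density
bounds force |rectangle| ≤ L |box|. Flatness of ψ along the segment produces such boxes.

Compare subgradients p, r at heights t < T above m. If the normal slope grows by at most κ and 4Kt ≤
κT, then ψ minus the linear function with slope p oscillates by at most κT on the triangle over the
segment with apex m + Tv. Well inside it the subgradients lie in a box of sides 8κT/ℓ and 8κ, so ℓ²
≤ 512 L κ² (`sq_le_of_normal_slope_increment_le`). For κ = ℓ / (32 √L) this is false, so each
multiplication of the height by 4K/κ costs more than κ of normal slope. The total available is K, so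
at most z = K/κ steps fit below δ (`natCast_mul_le_of_pow_mul_lt`). Hence δ/γ is at most about
(4z)^(z+1), and its logarithm is far below z ^ 8, which is the claimed bound up to a constant.

The count needs z bounded below; `area_le_of_flat_segment` at height δ supplies this, or settles the
case of bounded δ/γ directly. -/

/-! ### Subgradients of a convex function -/

/-- A finite convex function on the plane has a subgradient at every point. -/
theorem subdiff_nonempty {ψ : Plane → ℝ} (hψ : ConvexOn ℝ Set.univ ψ) (x : Plane) :
    (subdiff ψ x).Nonempty := by
  have hcont : Continuous ψ := hψ.locallyLipschitz.continuous
  have hconv : Convex ℝ {p : Plane × ℝ | p.1 ∈ Set.univ ∧ ψ p.1 < p.2} :=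
    hψ.convex_strict_epigraph
  have hopen : IsOpen {p : Plane × ℝ | p.1 ∈ Set.univ ∧ ψ p.1 < p.2} := by
    simpa using isOpen_lt (hcont.comp continuous_fst) continuous_snd
  obtain ⟨f, hf⟩ := geometric_hahn_banach_point_open (x := (x, ψ x)) hconv hopen (by simp)
  have hsplit : ∀ (y : Plane) (r : ℝ), f (y, r) = f (y, 0) + r * f (0, 1) := by
    intro y r
    have : ((y, r) : Plane × ℝ) = (y, 0) + r • ((0 : Plane), (1 : ℝ)) := by simp
    rw [this, map_add, map_smul, smul_eq_mul]
  set c := f (0, 1) with hc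
  -- The separating hyperplane is not vertical, so it is the graph of an affine function.
  have hcpos : 0 < c := by
    have := hf (x, ψ x + 1) (by simp)
    rw [hsplit x (ψ x), hsplit x (ψ x + 1)] at this
    linarith
  have hle : ∀ y, f (x, 0) + ψ x * c ≤ f (y, 0) + ψ y * c := by
    intro y
    refine le_of_forall_pos_lt_add fun η hη => ?_
    have := hf (y, ψ y + η / c) (by simp; positivity)
    rw [hsplit x (ψ x), hsplit y (ψ y + η / c), add_mul, div_mul_cancel₀ _ hcpos.ne'] at this
    linarith
  let g : StrongDual ℝ Plane := f.comp (ContinuousLinearMap.inl ℝ Plane ℝ)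
  have hg : ∀ y, g y = f (y, 0) := fun y => by simp [g]
  refine ⟨-(c⁻¹ • (InnerProductSpace.toDual ℝ Plane).symm g), fun y => ?_⟩
  have hsub : g (y - x) = f (y, 0) - f (x, 0) := by rw [map_sub, hg, hg]
  rw [inner_neg_left, real_inner_smul_left, InnerProductSpace.toDual_symm_apply, hsub]
  have h := hle y
  have : c⁻¹ * (f (x, 0) - f (y, 0)) ≤ ψ y - ψ x := by
    rw [inv_mul_le_iff₀ hcpos]; linarith
  linarith

theorem subdiff_subset_subdiffImage {ψ : Plane → ℝ} {A : Set Plane} {x : Plane} (hx : x ∈ A) :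
    subdiff ψ x ⊆ subdiffImage ψ A :=
  Set.subset_biUnion_of_mem (u := fun x => subdiff ψ x) hx

theorem mem_subdiffImage {ψ : Plane → ℝ} {A : Set Plane} {q : Plane} :
    q ∈ subdiffImage ψ A ↔ ∃ x ∈ A, q ∈ subdiff ψ x := by
  simp [subdiffImage]

/-- The subgradient inequality in the affine coordinates given by `m`, `u`, `v`. -/
theorem subdiff_coord_le {ψ : Plane → ℝ} {m u v q : Plane} {a s : ℝ}
    (hq : q ∈ subdiff ψ (m + a • u + s • v)) (a' s' : ℝ) :
    ψ (m + a • u + s • v) + (a' - a) * inner ℝ q u + (s' - s) * inner ℝ q v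
      ≤ ψ (m + a' • u + s' • v) := by
  have h := hq (m + a' • u + s' • v)
  have e : m + a' • u + s' • v - (m + a • u + s • v) = (a' - a) • u + (s' - s) • v := by module
  rw [e, inner_add_right, real_inner_smul_right, real_inner_smul_right] at h
  linarith

/-! ### Orthonormal frames, rectangles and area comparison -/

theorem exists_orthonormal_right {u : Plane} (hu : ‖u‖ = 1) :
    ∃ v : Plane, ‖v‖ = 1 ∧ inner ℝ u v = 0 := by
  rw [EuclideanSpace.norm_eq, Real.sqrt_eq_one, Fin.sum_univ_two] at hu
  refine ⟨!₂[-u 1, u 0], ?_, ?_⟩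
  · rw [EuclideanSpace.norm_eq, Real.sqrt_eq_one, Fin.sum_univ_two]
    simp only [Real.norm_eq_abs, sq_abs] at hu ⊢
    simp
    linarith
  · simp [PiLp.inner_apply, Fin.sum_univ_two]
    ring

/-- Expansion of a vector in an orthonormal basis of the plane. -/
theorem eq_inner_smul_add {u v : Plane} (hu : ‖u‖ = 1) (hv : ‖v‖ = 1) (huv : inner ℝ u v = 0)
    (q : Plane) : q = (inner ℝ q u : ℝ) • u + (inner ℝ q v : ℝ) • v := by
  have hon : Orthonormal ℝ ![u, v] := by
    constructor
    · intro i; fin_cases i <;> simpa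
    · intro i j hij
      fin_cases i <;> fin_cases j <;> simp_all [real_inner_comm]
  let b := basisOfOrthonormalOfCardEqFinrank hon (by simp)
  have hb : ⇑b = ![u, v] := coe_basisOfOrthonormalOfCardEqFinrank hon (by simp)
  let o := b.toOrthonormalBasis (by rw [hb]; exact hon)
  have ho : ⇑o = ![u, v] := by simp [o, hb]
  have h := o.sum_repr' q
  rw [Fin.sum_univ_two, ho] at h
  simpa [real_inner_comm] using h.symm

theorem measurableSet_rectangle (c u v : Plane) (a b : ℝ) :
    MeasurableSet (rectangle c u v a b) := by
  have : rectangle c u v a b = (fun p : ℝ × ℝ => c + p.1 • u + p.2 • v) ''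
      (Set.Icc (-(a / 2)) (a / 2) ×ˢ Set.Icc (-(b / 2)) (b / 2)) := by
    ext p
    simp only [rectangle, Set.mem_ofPred_eq, Set.mem_image, Set.mem_prod, Set.mem_Icc,
      Prod.exists, abs_le]
    constructor
    · rintro ⟨s, t, hs, ht, rfl⟩; exact ⟨s, t, ⟨hs, ht⟩, rfl⟩
    · rintro ⟨s, t, ⟨hs, ht⟩, rfl⟩; exact ⟨s, t, hs, ht, rfl⟩
  rw [this]
  exact ((isCompact_Icc.prod isCompact_Icc).image (by fun_prop)).measurableSet

/-- If the subgradients over a rectangle lie in a rectangle, the density bounds compare the areas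
of the two. -/
theorem area_le_of_subdiff_mem {ψ : Plane → ℝ} {Ω : Set Plane} {μ ν : Measure Plane}
    {h₁ h₂ lam₁ lam₂ : ℝ} (hpot : IsLocalPotential ψ Ω μ ν)
    (hD : DensityBounds ψ Ω μ ν h₁ h₂ lam₁ lam₂) {c u v p : Plane} {a b A B : ℝ}
    (hu : ‖u‖ = 1) (hv : ‖v‖ = 1) (huv : inner ℝ u v = 0)
    (ha : h₁ ≤ a) (hb : h₁ ≤ b) (hA : h₂ ≤ A) (hB : h₂ ≤ B)
    (hΩ : ∀ s t : ℝ, |s| ≤ a / 2 → |t| ≤ b / 2 → c + s • u + t • v ∈ Ω)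
    (hsub : ∀ s t : ℝ, |s| ≤ a / 2 → |t| ≤ b / 2 → ∀ q ∈ subdiff ψ (c + s • u + t • v),
      |inner ℝ q u - inner ℝ p u| ≤ A / 2 ∧ |inner ℝ q v - inner ℝ p v| ≤ B / 2) :
    a * b ≤ lam₁ * lam₂ * (A * B) := by
  have hRΩ : rectangle c u v a b ⊆ Ω := by
    rintro _ ⟨s, t, hs, ht, rfl⟩; exact hΩ s t hs ht
  have hpos₁ := hD.lam₁_pos
  have hpos₂ := hD.lam₂_pos
  have hApos : 0 < A := hD.h₂_pos.trans_le hA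
  have hBpos : 0 < B := hD.h₂_pos.trans_le hB
  have himage : subdiffImage ψ (rectangle c u v a b)
      ⊆ rectangle p u v A B ∩ subdiffImage ψ Ω := by
    intro q hq
    obtain ⟨z, hz, hqz⟩ := mem_subdiffImage.1 hq
    refine ⟨?_, mem_subdiffImage.2 ⟨z, hRΩ hz, hqz⟩⟩
    obtain ⟨s, t, hs, ht, rfl⟩ := hz
    obtain ⟨h1, h2⟩ := hsub s t hs ht q hqz
    refine ⟨_, _, h1, h2, ?_⟩
    nth_rw 1 [eq_inner_smul_add hu hv huv q]
    nth_rw 1 [eq_inner_smul_add hu hv huv p]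
    module
  have h := ((hD.lower c u v a b hu hv huv ha hb hRΩ).trans
    (hpot _ (measurableSet_rectangle c u v a b) hRΩ)).trans
    ((measure_mono himage).trans (hD.upper p u v A B hu hv huv hA hB))
  rw [ENNReal.ofReal_le_ofReal_iff (by positivity), div_le_iff₀ hpos₁] at h
  linarith

/-- The barycentric weights of the point are (1 - s/T ∓ a/ℓ)/2 and s/T; the hypothesis on `a` and
`s` makes them nonnegative. -/
theorem mem_of_mem_triangle {S : Set Plane} (hS : Convex ℝ S) {m u v : Plane} {ℓ T : ℝ}
    (hℓ : 0 < ℓ) (hT : 0 < T) (h₁ : m - ℓ • u ∈ S) (h₂ : m + ℓ • u ∈ S) (h₃ : m + T • v ∈ S)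
    {a s : ℝ} (hs : 0 ≤ s) (has : |a| / ℓ + s / T ≤ 1) : m + a • u + s • v ∈ S := by
  have hneg : -(a / ℓ) ≤ |a| / ℓ := by
    rw [← neg_div]; gcongr; exact neg_le_abs a
  have hpos : a / ℓ ≤ |a| / ℓ := by gcongr; exact le_abs_self a
  have hsT : 0 ≤ s / T := by positivity
  have h := hS.sum_mem (t := Finset.univ)
    (w := ![(1 - s / T - a / ℓ) / 2, (1 - s / T + a / ℓ) / 2, s / T])
    (z := ![m - ℓ • u, m + ℓ • u, m + T • v])
    (by
      intro i _
      fin_cases i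
      · change 0 ≤ (1 - s / T - a / ℓ) / 2; linarith
      · change 0 ≤ (1 - s / T + a / ℓ) / 2; linarith
      · exact hsT)
    (by simp [Fin.sum_univ_three]; ring)
    (by intro i _; fin_cases i <;> simpa)
  simp only [Fin.sum_univ_three, Matrix.cons_val] at h
  convert h using 1
  match_scalars <;> field_simp <;> ring

theorem abs_inner_sub_inner_le_dist {u : Plane} (hu : ‖u‖ = 1) (p q : Plane) :
    |(inner ℝ q u : ℝ) - inner ℝ p u| ≤ dist q p := by
  rw [← inner_sub_left, dist_eq_norm]
  simpa [hu] using abs_real_inner_le_norm (q - p) u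

/-! ### Area bound at a single height -/

/-- The crude area bound: over a strip of height comparable to `T` around the segment, the tangential
slopes vary by at most a multiple of `K * T / ℓ` and the normal ones by at most `2 * K`. -/
theorem area_le_of_flat_segment {ψ : Plane → ℝ} {Ω U : Set Plane} {μ ν : Measure Plane}
    {h₁ h₂ lam₁ lam₂ δ K ℓ ε T A B : ℝ} {m u v : Plane}
    (hψ : ConvexOn ℝ Set.univ ψ) (hpot : IsLocalPotential ψ Ω μ ν)
    (hD : DensityBounds ψ Ω μ ν h₁ h₂ lam₁ lam₂)
    (hu : ‖u‖ = 1) (hv : ‖v‖ = 1) (huv : inner ℝ u v = 0) (hUΩ : U ⊆ Ω)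
    (hU : ∀ a s : ℝ, |a| ≤ ℓ → |s| < δ → m + a • u + s • v ∈ U)
    (hK : ∀ p ∈ subdiffImage ψ U, ∀ q ∈ subdiffImage ψ U, dist p q ≤ K)
    (hgap : ψ (m - ℓ • u) + ψ (m + ℓ • u) ≤ 2 * ψ m + 2 * ε)
    (hKpos : 0 < K) (hℓ : 0 < ℓ) (hT : 0 < T) (hTδ : T ≤ δ) (hε : ε ≤ K * T)
    (hℓh : h₁ ≤ ℓ) (hTh : h₁ ≤ 3 / 2 * T) (hA : h₂ ≤ A) (hB : h₂ ≤ B)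
    (hA' : 11 * (K * T / ℓ) ≤ A) (hB' : 2 * K ≤ B) :
    ℓ * (3 / 2 * T) ≤ lam₁ * lam₂ * (A * B) := by
  obtain ⟨p, hp⟩ := subdiff_nonempty hψ (m + (0 : ℝ) • u + (0 : ℝ) • v)
  have hmemU : ∀ a s : ℝ, |a| ≤ ℓ → |s| < δ → ∀ q ∈ subdiff ψ (m + a • u + s • v),
      q ∈ subdiffImage ψ U := fun a s ha hs q hq =>
    subdiff_subset_subdiffImage (hU a s ha hs) hq
  have hpU := hmemU 0 0 (by simpa using hℓ.le) (by simpa using hT.trans_le hTδ) p hp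
  have hgap' : ψ (m + (-ℓ) • u + (0 : ℝ) • v) + ψ (m + ℓ • u + (0 : ℝ) • v)
      ≤ 2 * ψ (m + (0 : ℝ) • u + (0 : ℝ) • v) + 2 * ε := by
    simpa [sub_eq_add_neg] using hgap
  refine area_le_of_subdiff_mem hpot hD (c := m) (p := p) hu hv huv hℓh hTh hA hB ?_ ?_
  · intro s t hs ht
    exact hUΩ (hU s t (by linarith) (by linarith))
  · intro a s ha hs q hq
    have hsδ : |s| < δ := by linarith
    have hqU := hmemU a s (by linarith) hsδ q hq
    have hqp := hK q hqU p hpU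
    refine ⟨?_, (abs_inner_sub_inner_le_dist hv p q).trans (by linarith)⟩
    -- Follow q to the side a = ℓ, descend to the segment with r, and use p from below at (a, s) and
    -- (-ℓ, 0). The flatness of the chord leaves 2ε ≤ 2KT, the descent 3/4 KT.
    have hright : (ℓ - a) * (inner ℝ q u - inner ℝ p u) ≤ 11 / 4 * (K * T) := by
      obtain ⟨r, hr⟩ := subdiff_nonempty hψ (m + ℓ • u + s • v)
      have hrp := (abs_inner_sub_inner_le_dist hv p r).trans
        (hK r (hmemU ℓ s (by rw [abs_of_pos hℓ]) hsδ r hr) p hpU)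
      have h1 := subdiff_coord_le hq ℓ s
      have h2 := subdiff_coord_le hr ℓ 0
      have h3 := subdiff_coord_le hp a s
      have h4 := subdiff_coord_le hp (-ℓ) 0
      have h5 : s * (inner ℝ r v - inner ℝ p v) ≤ 3 / 4 * T * K :=
        (le_abs_self _).trans (by rw [abs_mul]; gcongr; linarith)
      linarith
    have hleft : (ℓ + a) * (inner ℝ p u - inner ℝ q u) ≤ 11 / 4 * (K * T) := by
      obtain ⟨r, hr⟩ := subdiff_nonempty hψ (m + (-ℓ) • u + s • v)
      have hrp := (abs_inner_sub_inner_le_dist hv p r).trans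
        (hK r (hmemU (-ℓ) s (by rw [abs_neg, abs_of_pos hℓ]) hsδ r hr) p hpU)
      have h1 := subdiff_coord_le hq (-ℓ) s
      have h2 := subdiff_coord_le hr (-ℓ) 0
      have h3 := subdiff_coord_le hp a s
      have h4 := subdiff_coord_le hp ℓ 0
      have h5 : s * (inner ℝ r v - inner ℝ p v) ≤ 3 / 4 * T * K :=
        (le_abs_self _).trans (by rw [abs_mul]; gcongr; linarith)
      linarith
    have key : ∀ w d : ℝ, ℓ / 2 ≤ w → w * d ≤ 11 / 4 * (K * T) → d ≤ A / 2 := by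
      intro w d hw hwd
      refine le_trans ?_ (by linarith : 11 / 2 * (K * T / ℓ) ≤ A / 2)
      rw [← mul_div_assoc, le_div_iff₀ hℓ]
      rcases le_total d 0 with hd | hd
      · nlinarith [mul_pos hKpos hT]
      · nlinarith
    obtain ⟨ha1, ha2⟩ := abs_le.1 ha
    rw [abs_le]
    have := key _ _ (by linarith) hright
    have := key _ _ (by linarith) hleft
    constructor <;> linarith

/-! ### Growth of the normal slope with height -/

/-- If the normal slope increases by at most `κ` between heights `t` and `T` above the segment,
where `K * t` is small compared to `κ * T`, then `κ` is not too small. -/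
theorem sq_le_of_normal_slope_increment_le {ψ : Plane → ℝ} {Ω U : Set Plane}
    {μ ν : Measure Plane} {h₁ h₂ lam₁ lam₂ δ K ℓ ε t T κ : ℝ} {m u v p r : Plane}
    (hψ : ConvexOn ℝ Set.univ ψ) (hpot : IsLocalPotential ψ Ω μ ν)
    (hD : DensityBounds ψ Ω μ ν h₁ h₂ lam₁ lam₂)
    (hu : ‖u‖ = 1) (hv : ‖v‖ = 1) (huv : inner ℝ u v = 0) (hUΩ : U ⊆ Ω)
    (hU : ∀ a s : ℝ, |a| ≤ ℓ → |s| < δ → m + a • u + s • v ∈ U)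
    (hK : ∀ p ∈ subdiffImage ψ U, ∀ q ∈ subdiffImage ψ U, dist p q ≤ K)
    (hgap : ψ (m - ℓ • u) + ψ (m + ℓ • u) ≤ 2 * ψ m + 2 * ε)
    (hℓ : 0 < ℓ) (ht : 0 < t) (htT : t < T) (hTδ : T < δ) (hκ : 0 < κ) (hε : ε ≤ K * t)
    (hKκ : 4 * K * t ≤ κ * T) (hℓh : 2 * h₁ ≤ ℓ) (hTh : 4 * h₁ ≤ T)
    (hh₂ : h₂ ≤ 8 * (κ * T / ℓ)) (hh₂' : h₂ ≤ 8 * κ)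
    (hp : p ∈ subdiff ψ (m + (0 : ℝ) • u + t • v)) (hr : r ∈ subdiff ψ (m + (0 : ℝ) • u + T • v))
    (hrp : inner ℝ r v - inner ℝ p v ≤ κ) :
    ℓ ^ 2 ≤ 512 * (lam₁ * lam₂) * κ ^ 2 := by
  have hT : 0 < T := ht.trans htT
  have hmemU : ∀ a s : ℝ, |a| ≤ ℓ → |s| < δ → ∀ q ∈ subdiff ψ (m + a • u + s • v),
      q ∈ subdiffImage ψ U := fun a s ha hs q hq =>
    subdiff_subset_subdiffImage (hU a s ha hs) hq
  have hpU := hmemU 0 t (by simpa using hℓ.le) (by rw [abs_of_pos ht]; linarith) p hp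
  have hgap' : ψ (m + (-ℓ) • u + (0 : ℝ) • v) + ψ (m + ℓ • u + (0 : ℝ) • v)
      ≤ 2 * ψ (m + (0 : ℝ) • u + (0 : ℝ) • v) + 2 * ε := by
    simpa [sub_eq_add_neg] using hgap
  -- Relative to the slope p, ψ has its minimum β - κT at height t, so β is the minimum plus the
  -- allowed oscillation.
  set β : ℝ := ψ (m + (0 : ℝ) • u + t • v) - t * inner ℝ p v + κ * T with hβ
  -- By convexity the vertices suffice. At the apex r gives the increment (T - t)κ; at m ± ℓu the
  -- excess is at most 2ε + 2Kt ≤ 4Kt ≤ κT.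
  have htri : ∀ a s : ℝ, 0 ≤ s → |a| / ℓ + s / T ≤ 1 →
      ψ (m + a • u + s • v) - a * inner ℝ p u - s * inner ℝ p v ≤ β := by
    have hconv : Convex ℝ {z ∈ Set.univ | ψ z - (innerSL ℝ p) z ≤ β - inner ℝ p m} :=
      (hψ.sub ((innerSL ℝ p).toLinearMap.concaveOn convex_univ)).convex_le _
    have hiff : ∀ a s : ℝ,
        m + a • u + s • v ∈ {z ∈ Set.univ | ψ z - (innerSL ℝ p) z ≤ β - inner ℝ p m} ↔
        ψ (m + a • u + s • v) - a * inner ℝ p u - s * inner ℝ p v ≤ β := by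
      intro a s
      simp only [Set.mem_univ, true_and, Set.mem_ofPred_eq, innerSL_apply_apply, inner_add_right,
        real_inner_smul_right]
      constructor <;> intro h <;> linarith
    obtain ⟨r₀, hr₀⟩ := subdiff_nonempty hψ (m + (0 : ℝ) • u + (0 : ℝ) • v)
    have hpr₀ := abs_le.1 ((abs_inner_sub_inner_le_dist hv r₀ p).trans (hK p hpU r₀
      (hmemU 0 0 (by simpa using hℓ.le) (by simpa using hT.trans hTδ) r₀ hr₀)))
    have h0 := subdiff_coord_le hr₀ 0 t
    have h0' : t * (inner ℝ p v - inner ℝ r₀ v) ≤ t * K := by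
      gcongr; exact hpr₀.2
    have hl := subdiff_coord_le hp (-ℓ) 0
    have hr' := subdiff_coord_le hp ℓ 0
    intro a s hs has
    rw [← hiff]
    refine mem_of_mem_triangle hconv hℓ hT ?_ ?_ ?_ hs has
    · have := (hiff (-ℓ) 0).2 (by linarith)
      simpa only [neg_smul, zero_smul, add_zero, ← sub_eq_add_neg] using this
    · have := (hiff ℓ 0).2 (by linarith)
      simpa only [zero_smul, add_zero] using this
    · have h1 := subdiff_coord_le hr 0 t
      have h2 : (T - t) * (inner ℝ r v - inner ℝ p v) ≤ (T - t) * κ := by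
        gcongr
      have h3 : 0 < t * κ := by positivity
      have := (hiff 0 T).2 (by linarith)
      simpa only [zero_smul, add_zero] using this
  have harea : ℓ / 2 * (T / 4) ≤ lam₁ * lam₂ * (8 * (κ * T / ℓ) * (8 * κ)) := by
    -- The rectangle |a| ≤ ℓ/4, T/4 ≤ height ≤ T/2 stays in the triangle when shifted by ±ℓ/4 along
    -- u or ±T/4 along v, so an oscillation κT bounds the slopes by 4κT/ℓ and 4κ.
    refine area_le_of_subdiff_mem hpot hD (c := m + (3 / 8 * T) • v) (p := p) hu hv huv
      (by linarith) (by linarith) hh₂ hh₂' ?_ ?_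
    · intro a s ha hs
      rw [abs_le] at hs
      have e : m + (3 / 8 * T) • v + a • u + s • v = m + a • u + (3 / 8 * T + s) • v := by module
      rw [e]
      refine hUΩ (hU _ _ (by linarith) ?_)
      rw [abs_lt]; constructor <;> linarith
    · intro a s ha hs q hq
      rw [abs_le] at hs
      have e : m + (3 / 8 * T) • v + a • u + s • v = m + a • u + (3 / 8 * T + s) • v := by module
      rw [e] at hq
      have hlow := subdiff_coord_le hp a (3 / 8 * T + s)
      have htest : ∀ a' s' : ℝ, 0 ≤ s' → |a'| / ℓ + s' / T ≤ 1 →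
          (a' - a) * (inner ℝ q u - inner ℝ p u)
            + (s' - (3 / 8 * T + s)) * (inner ℝ q v - inner ℝ p v) ≤ κ * T := by
        intro a' s' hs' h
        have h1 := subdiff_coord_le hq a' s'
        have h2 := htri a' s' hs' h
        linarith
      have hin : ∀ a' s' : ℝ, |a'| ≤ ℓ / 2 → s' ≤ T / 2 → |a'| / ℓ + s' / T ≤ 1 := by
        intro a' s' h1 h2
        have : |a'| / ℓ ≤ 1 / 2 := by rw [div_le_iff₀ hℓ]; linarith
        have : s' / T ≤ 1 / 2 := by rw [div_le_iff₀ hT]; linarith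
        linarith
      have hin' : ∀ a' s' : ℝ, |a'| ≤ ℓ / 4 → s' ≤ 3 / 4 * T → |a'| / ℓ + s' / T ≤ 1 := by
        intro a' s' h1 h2
        have : |a'| / ℓ ≤ 1 / 4 := by rw [div_le_iff₀ hℓ]; linarith
        have : s' / T ≤ 3 / 4 := by rw [div_le_iff₀ hT]; linarith
        linarith
      have haa := abs_le.1 ha
      have hs0 : 0 ≤ 3 / 8 * T + s := by linarith
      have h1 := htest (a + ℓ / 4) _ hs0
        (hin _ _ (by rw [abs_le]; constructor <;> linarith) (by linarith))
      have h2 := htest (a - ℓ / 4) _ hs0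
        (hin _ _ (by rw [abs_le]; constructor <;> linarith) (by linarith))
      have h3 := htest a (3 / 8 * T + s + T / 4) (by linarith) (hin' _ _ (by linarith) (by linarith))
      have h4 := htest a (3 / 8 * T + s - T / 4) (by linarith) (hin' _ _ (by linarith) (by linarith))
      have hbound : |inner ℝ q u - inner ℝ p u| ≤ 4 * (κ * T) / ℓ := by
        rw [le_div_iff₀ hℓ, ← abs_of_pos hℓ, ← abs_mul, abs_le]
        constructor <;> linarith
      have hbound' : |inner ℝ q v - inner ℝ p v| ≤ 4 * κ := by
        refine le_of_mul_le_mul_right ?_ hT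
        rw [← abs_of_pos hT, ← abs_mul, abs_of_pos hT, abs_le]
        constructor <;> linarith
      constructor
      · refine hbound.trans (le_of_eq ?_); ring
      · linarith
  have h : ℓ / 2 * (T / 4) * ℓ ≤ lam₁ * lam₂ * (8 * (κ * T / ℓ) * (8 * κ)) * ℓ := by gcongr
  have e : lam₁ * lam₂ * (8 * (κ * T / ℓ) * (8 * κ)) * ℓ
      = 64 * (lam₁ * lam₂) * κ ^ 2 * T := by field_simp; ring
  rw [e] at h
  refine le_of_mul_le_mul_right ?_ hT
  linarith

/-- Along a geometric sequence of heights the normal slope increases by at least `κ` at every step,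
which bounds the number of steps below height `δ`. -/
theorem natCast_mul_le_of_pow_mul_lt {ψ : Plane → ℝ} {Ω U : Set Plane}
    {μ ν : Measure Plane} {h₁ h₂ lam₁ lam₂ δ K ℓ ε t κ : ℝ} {m u v : Plane}
    (hψ : ConvexOn ℝ Set.univ ψ) (hpot : IsLocalPotential ψ Ω μ ν)
    (hD : DensityBounds ψ Ω μ ν h₁ h₂ lam₁ lam₂)
    (hu : ‖u‖ = 1) (hv : ‖v‖ = 1) (huv : inner ℝ u v = 0) (hUΩ : U ⊆ Ω)
    (hU : ∀ a s : ℝ, |a| ≤ ℓ → |s| < δ → m + a • u + s • v ∈ U)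
    (hK : ∀ p ∈ subdiffImage ψ U, ∀ q ∈ subdiffImage ψ U, dist p q ≤ K)
    (hgap : ψ (m - ℓ • u) + ψ (m + ℓ • u) ≤ 2 * ψ m + 2 * ε)
    (hℓ : 0 < ℓ) (ht : 0 < t) (hκ : 0 < κ) (hε : ε ≤ K * t)
    (hKκ : κ < 4 * K) (hℓh : 2 * h₁ ≤ ℓ) (hth : 4 * h₁ ≤ t)
    (hh₂ : h₂ ≤ 32 * (K * t / ℓ)) (hh₂' : h₂ ≤ 8 * κ)
    (hsmall : 512 * (lam₁ * lam₂) * κ ^ 2 < ℓ ^ 2) (n : ℕ)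
    (hn : (4 * K / κ) ^ n * t < δ) : n * κ ≤ K := by
  -- The ratio turning 4Kt ≤ κT into an equality for consecutive heights.
  set Λ := 4 * K / κ with hΛ
  have hΛ1 : 1 < Λ := by rwa [hΛ, one_lt_div hκ]
  have hΛ0 : 0 < Λ := one_pos.trans hΛ1
  have hK0 : 0 < K := by linarith
  choose q hq using fun k : ℕ => subdiff_nonempty hψ (m + (0 : ℝ) • u + (Λ ^ k * t) • v)
  have hqU : ∀ k : ℕ, Λ ^ k * t < δ → q k ∈ subdiffImage ψ U := fun k hk =>
    subdiff_subset_subdiffImage (hU 0 (Λ ^ k * t) (by simpa using hℓ.le)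
      (by rwa [abs_of_pos (by positivity)])) (hq k)
  have hmono : ∀ k : ℕ, Λ ^ k * t < Λ ^ (k + 1) * t := fun k => by
    gcongr
    exact k.lt_succ_self
  have hstep : ∀ k : ℕ, Λ ^ (k + 1) * t < δ → κ ≤ inner ℝ (q (k + 1)) v - inner ℝ (q k) v := by
    intro k hk
    by_contra! hlt
    have htk : t ≤ Λ ^ k * t := le_mul_of_one_le_left ht.le (one_le_pow₀ hΛ1.le)
    have hκT : κ * (Λ ^ (k + 1) * t) = 4 * K * (Λ ^ k * t) := by
      rw [hΛ, pow_succ]; field_simp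
    refine hsmall.not_ge (sq_le_of_normal_slope_increment_le hψ hpot hD hu hv huv hUΩ hU hK hgap
      hℓ (by positivity) (hmono k) hk hκ (hε.trans (by gcongr)) hκT.ge hℓh
      (hth.trans (htk.trans (hmono k).le)) (hh₂.trans ?_) hh₂' (hq k) (hq (k + 1)) hlt.le)
    rw [hκT]
    have : K * t / ℓ ≤ K * (Λ ^ k * t) / ℓ := by gcongr
    calc 32 * (K * t / ℓ) ≤ 32 * (K * (Λ ^ k * t) / ℓ) := by linarith
      _ = _ := by ring
  have hsum : ∀ k : ℕ, Λ ^ k * t < δ → k * κ ≤ inner ℝ (q k) v - inner ℝ (q 0) v := by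
    intro k
    induction k with
    | zero => simp
    | succ k ih =>
      intro hk
      have h1 := ih ((hmono k).trans hk)
      have h2 := hstep k hk
      push_cast
      linarith
  have hlt0 : Λ ^ 0 * t < δ := lt_of_le_of_lt (by gcongr; exacts [hΛ1.le, n.zero_le]) hn
  exact (hsum n hn).trans ((le_abs_self _).trans ((abs_inner_sub_inner_le_dist hv _ _).trans
    (hK _ (hqU n hn) _ (hqU 0 hlt0))))

/-! ### Geometry of the segment and the final computation -/

/-- The chord gap controls the midpoint. -/
theorem add_le_of_chordGap {ψ : Plane → ℝ} (hψ : ConvexOn ℝ Set.univ ψ) (x y : Plane) :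
    ψ x + ψ y ≤ 2 * ψ (midpoint ℝ x y) + 2 * chordGap ψ x y := by
  have hcont : Continuous ψ := hψ.locallyLipschitz.continuous
  have hbdd : BddBelow ((fun t : ℝ => ψ ((1 - t) • x + t • y) - ((1 - t) * ψ x + t * ψ y)) ''
      Set.Icc 0 1) := (isCompact_Icc.image (by fun_prop)).bddBelow
  have h := csInf_le hbdd (Set.mem_image_of_mem _ (by norm_num : (1 / 2 : ℝ) ∈ Set.Icc 0 1))
  have e : ((1 - 1 / 2 : ℝ)) • x + (1 / 2 : ℝ) • y = midpoint ℝ x y := by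
    rw [midpoint_eq_smul_add, invOf_eq_inv]; module
  simp only [e] at h
  unfold chordGap
  linarith

theorem add_smul_add_smul_mem_segmentNhd {m u v : Plane} {ℓ δ a s : ℝ} (hv : ‖v‖ = 1) (hℓ : 0 < ℓ)
    (ha : |a| ≤ ℓ) (hs : |s| < δ) :
    m + a • u + s • v ∈ segmentNhd (m - ℓ • u) (m + ℓ • u) δ := by
  obtain ⟨h1, h2⟩ := abs_le.1 ha
  refine Set.mem_biUnion (x := m + a • u) ?_ (by simpa [norm_smul, hv] using hs)
  refine ⟨(ℓ - a) / (2 * ℓ), (ℓ + a) / (2 * ℓ), div_nonneg (by linarith) (by linarith),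
    div_nonneg (by linarith) (by linarith), by field_simp; ring, ?_⟩
  match_scalars <;> field_simp <;> ring

/-- The final computation, with `y = K / κ` in terms of the scale `κ` of slope increments, and
`n` the number of steps of ratio `4 * y` needed to reach `M`. -/
theorem log_one_add_le_of_le_pow {M y : ℝ} {n : ℕ} (hM : 0 ≤ M) (hy : 8 ≤ y)
    (hn : n ≤ y + 1) (hMn : M ≤ 10 ^ 4 * (4 * y) ^ n) :
    Real.log (1 + M) ≤ (10 ^ 4 * y ^ 2 / 1024) ^ 4 := by
  have hpow : 1 ≤ (4 * y) ^ n := one_le_pow₀ (by linarith)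
  have h4y : 0 < 4 * y := by linarith
  have h1 : Real.log (1 + M) ≤ Real.log (20000 * (4 * y) ^ n) :=
    Real.log_le_log (by linarith) (by linarith)
  rw [Real.log_mul (by norm_num) (by positivity), Real.log_pow] at h1
  have h2 : Real.log 20000 ≤ 20000 := Real.log_le_self (by norm_num)
  have h3 : n * Real.log (4 * y) ≤ (y + 1) * (4 * y) := by
    have := Real.log_nonneg (by linarith : 1 ≤ 4 * y)
    gcongr
    exact Real.log_le_self h4y.le
  have hX : 9 * y ^ 2 ≤ 10 ^ 4 * y ^ 2 / 1024 := by nlinarith [sq_nonneg y]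
  have hy2 : 64 ≤ y ^ 2 := by nlinarith
  have h4 : (9 * y ^ 2) ^ 4 ≤ (10 ^ 4 * y ^ 2 / 1024) ^ 4 := by gcongr
  -- Three of the four factors are spent on numerical constants: 576 ^ 3 outweighs the 20000 from
  -- the logarithm.
  have h5 : (9 * y ^ 2) * (9 * 64) ^ 3 ≤ (9 * y ^ 2) ^ 4 := by
    rw [pow_succ' (9 * y ^ 2) 3]; gcongr
  nlinarith

/-- The strict convexity estimate in coordinates adapted to the segment. -/
theorem pow_mul_log_le {ψ : Plane → ℝ} {Ω U : Set Plane}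
    {μ ν : Measure Plane} {h₁ h₂ lam₁ lam₂ δ K ℓ ε γ : ℝ} {m u v : Plane}
    (hψ : ConvexOn ℝ Set.univ ψ) (hpot : IsLocalPotential ψ Ω μ ν)
    (hD : DensityBounds ψ Ω μ ν h₁ h₂ lam₁ lam₂)
    (hu : ‖u‖ = 1) (hv : ‖v‖ = 1) (huv : inner ℝ u v = 0) (hUΩ : U ⊆ Ω)
    (hU : ∀ a s : ℝ, |a| ≤ ℓ → |s| < δ → m + a • u + s • v ∈ U)
    (hKd : ∀ p ∈ subdiffImage ψ U, ∀ q ∈ subdiffImage ψ U, dist p q ≤ K)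
    (hgap : ψ (m - ℓ • u) + ψ (m + ℓ • u) ≤ 2 * ψ m + 2 * ε)
    (hK : 0 < K) (hℓ0 : 0 < ℓ) (hδ : 0 < δ) (hℓh : 2 * h₁ ≤ ℓ)
    (hℓ2 : 10 ^ 4 * K * lam₁ * lam₂ * h₂ ≤ ℓ ^ 2) (hγε : ε ≤ K * γ) (hγh : 2 * h₁ ≤ γ)
    (hγh₂ : h₂ ≤ 10 ^ 4 * (K * γ / ℓ)) (hγδ : γ ≤ δ / 2) :
    ℓ ^ 8 * Real.log (1 + δ / γ) ≤ (10 ^ 4) ^ 4 * lam₁ ^ 4 * lam₂ ^ 4 * K ^ 8 := by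
  have hh₁ := hD.h₁_pos
  have hh₂ := hD.h₂_pos
  have hL : 0 < lam₁ * lam₂ := mul_pos hD.lam₁_pos hD.lam₂_pos
  have hγ0 : 0 < γ := by linarith
  have hM : 2 ≤ δ / γ := by rw [le_div_iff₀ hγ0]; linarith
  set M := δ / γ with hMdef
  have hMγ : M * γ = δ := div_mul_cancel₀ _ hγ0.ne'
  have hM0 : 0 < M := by linarith
  set z := K / (ℓ / (32 * √(lam₁ * lam₂))) with hz
  have hsq : √(lam₁ * lam₂) ^ 2 = lam₁ * lam₂ := Real.sq_sqrt hL.le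
  have hs0 : 0 < √(lam₁ * lam₂) := Real.sqrt_pos.2 hL
  have hz0 : 0 < z := by positivity
  have hz2 : z ^ 2 * ℓ ^ 2 = 1024 * (lam₁ * lam₂) * K ^ 2 := by
    rw [← hsq, hz]; field_simp; norm_num
  suffices hlog : Real.log (1 + M) ≤ (10 ^ 4 * z ^ 2 / 1024) ^ 4 by
    calc ℓ ^ 8 * Real.log (1 + M) ≤ ℓ ^ 8 * (10 ^ 4 * z ^ 2 / 1024) ^ 4 := by gcongr
      _ = (10 ^ 4 * (z ^ 2 * ℓ ^ 2) / 1024) ^ 4 := by ring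
      _ = (10 ^ 4) ^ 4 * lam₁ ^ 4 * lam₂ ^ 4 * K ^ 8 := by rw [hz2]; ring
  -- The strip of height δ. The term 10 ^ 4 / M makes the tangential side at least h₂, as h₂ ≤ 10 ^
  -- 4 K γ / ℓ and γ = δ / M.
  have hwide : 3 / 2 * ℓ ^ 2 ≤ 2 * max 11 (10 ^ 4 / M) * (lam₁ * lam₂) * K ^ 2 := by
    set b := max 11 (10 ^ 4 / M) with hb
    have hb11 : 11 ≤ b := le_max_left _ _
    have hbM : 10 ^ 4 / M ≤ b := le_max_right _ _
    have hb4 : b ≤ 10 ^ 4 := max_le (by norm_num) (div_le_self (by norm_num) (by linarith))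
    have hKδ : 0 < K * δ / ℓ := by positivity
    have hA : h₂ ≤ b * (K * δ / ℓ) := by
      refine hγh₂.trans (le_trans (le_of_eq ?_) (mul_le_mul_of_nonneg_right hbM hKδ.le))
      rw [← hMγ]; field_simp
    have hKγδ : K * γ ≤ K * δ := by gcongr; linarith
    have h := area_le_of_flat_segment hψ hpot hD hu hv huv hUΩ hU hKd hgap hK hℓ0 hδ le_rfl
      (hγε.trans hKγδ) (by linarith) (by linarith) hA
      (le_max_right (2 * K) h₂) (by gcongr) (le_max_left (2 * K) h₂)
    have h' : 3 / 2 * ℓ ^ 2 ≤ b * (lam₁ * lam₂) * K * max (2 * K) h₂ := by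
      have e : lam₁ * lam₂ * (b * (K * δ / ℓ) * max (2 * K) h₂)
          = b * (lam₁ * lam₂) * K * max (2 * K) h₂ * (δ / ℓ) := by ring
      rw [e, show ℓ * (3 / 2 * δ) = 3 / 2 * ℓ ^ 2 * (δ / ℓ) by field_simp] at h
      exact le_of_mul_le_mul_right h (by positivity)
    rcases le_total h₂ (2 * K) with hc | hc
    · rw [max_eq_left hc] at h'; linarith
    -- Here h₂ ≥ 2K is contradictory: the area bound gives 3/2 ℓ² ≤ 10 ^ 4 K L h₂ ≤ ℓ².
    · rw [max_eq_right hc] at h'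
      have : b * (lam₁ * lam₂ * K * h₂) ≤ 10 ^ 4 * (lam₁ * lam₂ * K * h₂) := by gcongr
      have : 0 < ℓ ^ 2 := by positivity
      linarith
  have hX : 3 / 4 * 1024 ≤ max 11 (10 ^ 4 / M) * z ^ 2 := by
    refine le_of_mul_le_mul_right ?_ (by positivity : 0 < ℓ ^ 2)
    rw [mul_assoc _ (z ^ 2), hz2]; linarith
  rcases le_total 11 (10 ^ 4 / M) with hcase | hcase
  · rw [max_eq_right hcase] at hX
    -- M is bounded here, so no iteration is needed; M ≥ 2 lets the fourth power of 3/4 M dominate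
    -- M.
    have h34 : 3 / 4 * M ≤ 10 ^ 4 * z ^ 2 / 1024 := by
      rw [div_mul_eq_mul_div (10 ^ 4), le_div_iff₀ hM0] at hX; linarith
    calc Real.log (1 + M) ≤ M := by
          have := Real.log_le_sub_one_of_pos (by linarith : 0 < 1 + M); linarith
      _ ≤ 3 / 4 * M * (3 / 4 * 2) ^ 3 := by linarith
      _ ≤ 3 / 4 * M * (3 / 4 * M) ^ 3 := by gcongr
      _ = (3 / 4 * M) ^ 4 := by ring
      _ ≤ _ := by gcongr
  · rw [max_eq_left hcase] at hX
    have hz8 : 8 ≤ z := by nlinarith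
    set κ := ℓ / (32 * √(lam₁ * lam₂)) with hκ
    have hκ0 : 0 < κ := by positivity
    have hKz : K = z * κ := (div_mul_cancel₀ _ hκ0.ne').symm
    have hκ2 : ℓ ^ 2 = 1024 * (lam₁ * lam₂) * κ ^ 2 := by
      rw [← hsq, hκ]; field_simp; norm_num
    have hΛ : 4 * K / κ = 4 * z := by rw [hz]; ring
    clear_value z κ
    have hκK : κ < 4 * K := by
      have : 8 * κ ≤ z * κ := by gcongr
      linarith
    have hh₂κ : h₂ ≤ 8 * κ := by
      rw [hκ2, hKz] at hℓ2
      have h1 : (lam₁ * lam₂ * κ) * (10 ^ 4 * z * h₂) ≤ (lam₁ * lam₂ * κ) * (1024 * κ) := by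
        linarith
      have h2 := le_of_mul_le_mul_left h1 (by positivity)
      nlinarith
    have hsmall : 512 * (lam₁ * lam₂) * κ ^ 2 < ℓ ^ 2 := by
      have := mul_pos hL (pow_pos hκ0 2)
      linarith
    have hC : γ ≤ 10 ^ 4 * γ := by linarith
    -- Starting at height 10 ^ 4 γ rather than γ makes the box sides at least h₂ at every step.
    have hcount := natCast_mul_le_of_pow_mul_lt (t := 10 ^ 4 * γ) hψ hpot hD hu hv huv hUΩ hU hKd
      hgap hℓ0 (by positivity) hκ0 (hγε.trans (by gcongr)) hκK hℓh
      (by linarith) (hγh₂.trans (by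
        have : 0 < K * γ / ℓ := by positivity
        rw [show K * (10 ^ 4 * γ) / ℓ = 10 ^ 4 * (K * γ / ℓ) by ring]; linarith)) hh₂κ
      hsmall
    rw [hΛ] at hcount
    have hex : ∃ n : ℕ, δ ≤ (4 * z) ^ n * (10 ^ 4 * γ) := by
      obtain ⟨n, hn⟩ := pow_unbounded_of_one_lt (δ / (10 ^ 4 * γ)) (by linarith : 1 < 4 * z)
      exact ⟨n, by rw [div_lt_iff₀ (by positivity)] at hn; exact hn.le⟩
    classical
    -- The least n whose height reaches δ: the previous height is still below δ, so n - 1 ≤ z.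
    refine log_one_add_le_of_le_pow (n := Nat.find hex) hM0.le hz8 ?_ ?_
    · rcases hn : Nat.find hex with _ | k
      · simp; linarith
      · have hk := hcount k (not_le.1 (Nat.find_min hex (hn ▸ k.lt_succ_self)))
        have : (k : ℝ) ≤ z := le_of_mul_le_mul_right (hk.trans_eq hKz) hκ0
        push_cast; linarith
    · have := Nat.find_spec hex
      rw [hMdef, div_le_iff₀ hγ0]; linarith

theorem theorem1p3 :
    ∃ C : ℝ, 0 < C ∧
      ∀ (Ω : Set Plane) (μ ν : Measure Plane) [IsLocallyFiniteMeasure μ]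
        [IsLocallyFiniteMeasure ν] (ψ : Plane → ℝ) (h₁ h₂ lam₁ lam₂ δ K ℓ γ : ℝ) (x y : Plane),
        IsOpen Ω → Bornology.IsBounded Ω →
        ConvexOn ℝ Set.univ ψ →
        IsLocalPotential ψ Ω μ ν →
        DensityBounds ψ Ω μ ν h₁ h₂ lam₁ lam₂ →
        0 < δ → x ∈ innerSet Ω δ → y ∈ innerSet Ω δ → segmentNhd x y δ ⊆ Ω →
        0 < K → Metric.ediam (subdiffImage ψ (segmentNhd x y δ)) ≤ ENNReal.ofReal K →
        ℓ = dist x y / 2 →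
        2 * h₁ ≤ ℓ → C * K * lam₁ * lam₂ * h₂ ≤ ℓ ^ 2 →
        γ = max (chordGap ψ x y / K) (max (2 * h₁) (ℓ * h₂ / (C * K))) →
        γ ≤ δ / 2 →
        ℓ ^ 8 * Real.log (1 + δ / γ) ≤ C ^ 4 * lam₁ ^ 4 * lam₂ ^ 4 * K ^ 8 := by
  refine ⟨10 ^ 4, by norm_num, ?_⟩
  intro Ω μ ν _ _ ψ h₁ h₂ lam₁ lam₂ δ K ℓ γ x y _ _ hψ hpot hD hδ _ _ hUΩ hK hdiam hℓ hℓh hℓ2 hγ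
    hγδ
  have hh₁ := hD.h₁_pos
  have hℓ0 : 0 < ℓ := by linarith
  have hγε : chordGap ψ x y ≤ K * γ := by
    rw [mul_comm, ← div_le_iff₀ hK, hγ]; exact le_max_left _ _
  have hγh : 2 * h₁ ≤ γ := by rw [hγ]; exact (le_max_left _ _).trans (le_max_right _ _)
  have hγh₂ : h₂ ≤ 10 ^ 4 * (K * γ / ℓ) := by
    have : ℓ * h₂ / (10 ^ 4 * K) ≤ γ := by
      rw [hγ]; exact (le_max_right _ _).trans (le_max_right _ _)
    rw [div_le_iff₀ (by positivity)] at this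
    rw [← mul_div_assoc, le_div_iff₀ hℓ0]; linarith
  set m := midpoint ℝ x y with hm
  set u := (2 * ℓ)⁻¹ • (y - x) with hudef
  have hu : ‖u‖ = 1 := by
    rw [hudef, norm_smul, ← dist_eq_norm, dist_comm, Real.norm_eq_abs,
      abs_of_pos (by positivity), show dist x y = 2 * ℓ by linarith]
    exact inv_mul_cancel₀ (by positivity)
  obtain ⟨v, hv, huv⟩ := exists_orthonormal_right hu
  have hℓu : ℓ • u = (1 / 2 : ℝ) • (y - x) := by
    rw [hudef, smul_smul]; congr 1; field_simp
  have hx : m - ℓ • u = x := by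
    rw [hℓu, hm, midpoint_eq_smul_add, invOf_eq_inv]; module
  have hy : m + ℓ • u = y := by
    rw [hℓu, hm, midpoint_eq_smul_add, invOf_eq_inv]; module
  have hU : ∀ a s : ℝ, |a| ≤ ℓ → |s| < δ → m + a • u + s • v ∈ segmentNhd x y δ := by
    intro a s ha hs
    have := add_smul_add_smul_mem_segmentNhd (m := m) (u := u) hv hℓ0 ha hs
    rwa [hx, hy] at this
  have hKd : ∀ p ∈ subdiffImage ψ (segmentNhd x y δ), ∀ q ∈ subdiffImage ψ (segmentNhd x y δ),
      dist p q ≤ K := by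
    intro p hp q hq
    have := (Metric.edist_le_ediam_of_mem hp hq).trans hdiam
    rwa [edist_dist, ENNReal.ofReal_le_ofReal_iff hK.le] at this
  have hgap : ψ (m - ℓ • u) + ψ (m + ℓ • u) ≤ 2 * ψ m + 2 * chordGap ψ x y := by
    rw [hx, hy]; exact add_le_of_chordGap hψ x y
  exact pow_mul_log_le hψ hpot hD hu hv huv hUΩ hU hKd hgap hK hℓ0 hδ hℓh hℓ2 hγε hγh hγh₂ hγδ
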